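/- Let $H$ be a complex Hilbert space. Let $W^{1,2}([0,1],H)$ be the space of all functions $f:[0,1]\to H$ for which there is a (strongly) measurable $g:[0,1]\to H$ with $\int_0^1\|g(t)\|^2\,dt<\infty$ and $f(x)=f(0)+\int_0^x g(t)\,dt$ (Bochner integral) for every $x\in[0,1]$. The function $g$ is unique up to a null set and is denoted $f'$. Equip $W^{1,2}([0,1],H)$ with the inner product $$\langle f,g\rangle=\int_0^1\bigl(\langle f(t),g(t)\rangle_H+\langle f'(t),g'(t)\rangle_H\bigr)\,dt$$ and the resulting norm topology. Let $W^{1,2}[0,1]=W^{1,2}([0,1],\mathbb C)$, which is a commutative unital algebra under pointwise multiplication and acts on $W^{1,2}([0,1],H)$ by pointwise multiplication. A Banach module $M$ over a unital commutative complex Banach algebra is called nice if every proper closed submodule of $M$ is contained in a closed submodule of $M$ of (complex) codimension $1$. Then the $W^{1,2}[0,1]$-module $W^{1,2}([0,1],H)$ is nice if and only if $H$ is finite dimensional. -/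

import Mathlib

open MeasureTheory Set Filter
open scoped Topology unitInterval ComplexConjugate

/-!
## Nice modules
-/

/-- An `A`-module `M` is *nice* if every proper closed submodule of `M` is contained in a closed
submodule of `M` of (complex) codimension one. Only the topology of `M` and the actions of `A` and
of `ℂ` enter the definition; it is meant for a Banach module over a unital complex Banach
algebra. -/
def IsNiceModule (A M : Type*) [CommRing A] [Algebra ℂ A] [AddCommGroup M] [TopologicalSpace M]
    [Module ℂ M] [Module A M] [IsScalarTower ℂ A M] : Prop :=
  ∀ N : Submodule A M, IsClosed (N : Set M) → N ≠ ⊤ →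
    ∃ P : Submodule A M, IsClosed (P : Set M) ∧ N ≤ P ∧ Module.finrank ℂ (M ⧸ P) = 1

/-!
## Absolutely continuous functions with square integrable derivative
-/

/-- The constant extension to the line of a function on `[0,1]`, used to write integrals over
`[0,1]` as interval integrals. -/
noncomputable def extendI {H : Type*} (f : I → H) : ℝ → H := IccExtend (zero_le_one : (0 : ℝ) ≤ 1) f

theorem extendI_of_mem {H : Type*} (f : I → H) {t : ℝ} (ht : t ∈ Icc (0 : ℝ) 1) : extendI f t = f ⟨t, ht⟩ :=
  IccExtend_of_mem _ _ ht

theorem extendI_coe {H : Type*} (f : I → H) (t : I) : extendI f t = f t :=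
  extendI_of_mem f t.2

section

variable {H : Type*} [NormedAddCommGroup H] [InnerProductSpace ℂ H]

/-- `f : [0,1] → H` is the indefinite Bochner integral of the square integrable function `g` on
`[0,1]`, i.e. `f` is absolutely continuous with `f' = g` and `∫₀¹ ‖g(t)‖² dt < ∞`. The values of
`g` outside `[0,1]` are irrelevant. -/
def HasL2Deriv (f : I → H) (g : ℝ → H) : Prop :=
  MemLp g 2 (volume.restrict (Icc (0 : ℝ) 1)) ∧ ∀ x : I, f x = f 0 + ∫ t in (0 : ℝ)..x, g t

namespace HasL2Deriv

variable {f f₁ f₂ : I → H} {g g₁ g₂ : ℝ → H}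

theorem integrableOn (h : HasL2Deriv f g) : IntegrableOn g (Icc (0 : ℝ) 1) :=
  h.1.integrable (by norm_num)

theorem intervalIntegrable (h : HasL2Deriv f g) {a b : ℝ} (ha : a ∈ Icc (0 : ℝ) 1)
    (hb : b ∈ Icc (0 : ℝ) 1) : IntervalIntegrable g volume a b := by
  rw [intervalIntegrable_iff]
  refine h.integrableOn.mono_set (uIoc_subset_uIcc.trans ?_)
  exact uIcc_subset_Icc ha hb

theorem extendI_eq (h : HasL2Deriv f g) {x : ℝ} (hx : x ∈ Icc (0 : ℝ) 1) :
    extendI f x = f 0 + ∫ t in (0 : ℝ)..x, g t := by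
  rw [extendI_of_mem f hx]; exact h.2 ⟨x, hx⟩

theorem const (c : H) : HasL2Deriv (fun _ ↦ c) 0 :=
  ⟨MemLp.zero, fun x ↦ by simp⟩

theorem add (h₁ : HasL2Deriv f₁ g₁) (h₂ : HasL2Deriv f₂ g₂) :
    HasL2Deriv (f₁ + f₂) (g₁ + g₂) := by
  refine ⟨h₁.1.add h₂.1, fun x ↦ ?_⟩
  have := intervalIntegral.integral_add (μ := volume)
    (h₁.intervalIntegrable ⟨le_rfl, zero_le_one⟩ x.2)
    (h₂.intervalIntegrable ⟨le_rfl, zero_le_one⟩ x.2)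
  simp only [Pi.add_apply]
  rw [this, h₁.2 x, h₂.2 x]
  abel

theorem neg (h : HasL2Deriv f g) : HasL2Deriv (-f) (-g) := by
  refine ⟨h.1.neg, fun x ↦ ?_⟩
  simp only [Pi.neg_apply]
  rw [intervalIntegral.integral_neg, h.2 x]
  abel

theorem const_smul (c : ℂ) (h : HasL2Deriv f g) : HasL2Deriv (c • f) (c • g) := by
  refine ⟨h.1.const_smul c, fun x ↦ ?_⟩
  simp only [Pi.smul_apply]
  rw [intervalIntegral.integral_smul, h.2 x, smul_add]

theorem absolutelyContinuous (h : HasL2Deriv f g) :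
    AbsolutelyContinuousOnInterval (extendI f) 0 1 := by
  have hg := h.intervalIntegrable (a := 0) (b := 1) ⟨le_rfl, zero_le_one⟩ ⟨zero_le_one, le_rfl⟩
  have key := hg.norm.absolutelyContinuousOnInterval_intervalIntegral (c := 0) left_mem_uIcc
  rw [absolutelyContinuousOnInterval_iff] at key ⊢
  intro ε hε
  obtain ⟨δ, hδ, hE⟩ := key ε hε
  refine ⟨δ, hδ, fun E hd hl ↦ lt_of_le_of_lt (Finset.sum_le_sum fun i hi ↦ ?_) (hE E hd hl)⟩
  have hm := hd.1 i hi
  rw [uIcc_of_le zero_le_one] at hm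
  obtain ⟨ha, hb⟩ := hm
  have z : (0 : ℝ) ∈ Icc (0 : ℝ) 1 := ⟨le_rfl, zero_le_one⟩
  rw [h.extendI_eq ha, h.extendI_eq hb, dist_add_left, dist_eq_norm, dist_eq_norm,
    intervalIntegral.integral_interval_sub_left (h.intervalIntegrable z ha)
      (h.intervalIntegrable z hb),
    intervalIntegral.integral_interval_sub_left (h.intervalIntegrable z ha).norm
      (h.intervalIntegrable z hb).norm]
  exact intervalIntegral.norm_integral_le_abs_integral_norm

theorem continuousOn (h : HasL2Deriv f g) : ContinuousOn (extendI f) (Icc (0 : ℝ) 1) := by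
  simpa [uIcc_of_le (zero_le_one : (0 : ℝ) ≤ 1)] using h.absolutelyContinuous.continuousOn

theorem memLp (h : HasL2Deriv f g) (p : ENNReal) :
    MemLp (extendI f) p (volume.restrict (Icc (0 : ℝ) 1)) := by
  obtain ⟨C, hC⟩ := isCompact_Icc.exists_bound_of_continuousOn h.continuousOn
  exact MemLp.of_bound (h.continuousOn.aestronglyMeasurable_of_isCompact isCompact_Icc
    measurableSet_Icc) C ((ae_restrict_iff' measurableSet_Icc).2 (Eventually.of_forall hC))

theorem ae_hasDerivAt [CompleteSpace H] (h : HasL2Deriv f g) :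
    ∀ᵐ x : ℝ, x ∈ Icc (0 : ℝ) 1 → HasDerivAt (extendI f) (g x) x := by
  have hg := h.intervalIntegrable (a := 0) (b := 1) ⟨le_rfl, zero_le_one⟩ ⟨zero_le_one, le_rfl⟩
  have h₁ : ∀ᵐ x : ℝ, x ≠ 0 := by simp [ae_iff, measure_singleton]
  have h₂ : ∀ᵐ x : ℝ, x ≠ 1 := by simp [ae_iff, measure_singleton]
  filter_upwards [hg.ae_hasDerivAt_integral, h₁, h₂] with x hx h0 h1 hm
  rw [uIcc_of_le zero_le_one] at hx
  refine ((hx hm 0 ⟨le_rfl, zero_le_one⟩).const_add (f 0)).congr_of_eventuallyEq ?_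
  filter_upwards [Ioo_mem_nhds (lt_of_le_of_ne hm.1 (Ne.symm h0)) (lt_of_le_of_ne hm.2 h1)]
    with y hy
  exact h.extendI_eq (Ioo_subset_Icc_self hy)

/-- The derivative is unique up to a Lebesgue null set. -/
theorem unique [CompleteSpace H] (h₁ : HasL2Deriv f g₁) (h₂ : HasL2Deriv f g₂) :
    g₁ =ᵐ[volume.restrict (Icc (0 : ℝ) 1)] g₂ := by
  rw [EventuallyEq, ae_restrict_iff' measurableSet_Icc]
  filter_upwards [h₁.ae_hasDerivAt, h₂.ae_hasDerivAt] with x hx₁ hx₂ hx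
  exact (hx₁ hx).unique (hx₂ hx)

/-- The product rule. -/
theorem smul [CompleteSpace H] {a : I → ℂ} {u : ℝ → ℂ} (ha : HasL2Deriv a u)
    (hf : HasL2Deriv f g) :
    HasL2Deriv (fun t ↦ a t • f t) (fun t ↦ u t • extendI f t + extendI a t • g t) := by
  have hL : MemLp (fun t ↦ u t • extendI f t + extendI a t • g t) 2
      (volume.restrict (Icc (0 : ℝ) 1)) :=
    ((hf.memLp ⊤).smul ha.1 (r := 2)).add (hf.1.smul (ha.memLp ⊤) (r := 2))
  have z : (0 : ℝ) ∈ Icc (0 : ℝ) 1 := ⟨le_rfl, zero_le_one⟩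
  set w : ℝ → H := fun t ↦ u t • extendI f t + extendI a t • g t with hw
  -- `W` is the indefinite integral of `w`
  let W : I → H := fun x ↦ ∫ t in (0 : ℝ)..x, w t
  have hW : HasL2Deriv W w := ⟨hL, fun x ↦ by simp [W]⟩
  have hac : AbsolutelyContinuousOnInterval (extendI a • extendI f - extendI W) 0 1 :=
    (ha.absolutelyContinuous.smul hf.absolutelyContinuous).sub hW.absolutelyContinuous
  have hd : ∀ᵐ x : ℝ, x ∈ uIcc (0 : ℝ) 1 →
      HasDerivAt (extendI a • extendI f - extendI W) 0 x := by
    filter_upwards [ha.ae_hasDerivAt, hf.ae_hasDerivAt, hW.ae_hasDerivAt] with x h1 h2 h3 hx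
    rw [uIcc_of_le zero_le_one] at hx
    have := ((h1 hx).smul (h2 hx)).sub (h3 hx)
    refine this.congr_deriv ?_
    simp only [hw]
    abel
  obtain ⟨C, hC⟩ := hac.const_of_ae_hasDerivAt_zero hd
  rw [uIcc_of_le zero_le_one] at hC
  refine ⟨hL, fun x ↦ ?_⟩
  have e1 := (hC x x.2).trans (hC 0 z).symm
  have e0 : extendI a 0 • extendI f 0 = a 0 • f 0 := by
    rw [extendI_of_mem a z, extendI_of_mem f z]; rfl
  have e2 : extendI W 0 = 0 := by
    rw [extendI_of_mem W z]; simp [W]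
  simp only [Pi.sub_apply, Pi.smul_apply', extendI_coe, e0, e2, sub_zero] at e1
  exact sub_eq_iff_eq_add.1 e1

end HasL2Deriv

end

/-!
## The Sobolev space `W^{1,2}([0,1], H)`
-/

/-- The space `W^{1,2}([0,1], H)` of absolutely continuous functions `f : [0,1] → H` with
`∫₀¹ ‖f'(t)‖² dt < ∞`. -/
@[ext]
structure W12 (H : Type*) [NormedAddCommGroup H] [InnerProductSpace ℂ H] where
  /-- the function itself -/
  toFun : I → H
  exists_deriv : ∃ g : ℝ → H, HasL2Deriv toFun g

namespace W12

section

variable {H : Type*} [NormedAddCommGroup H] [InnerProductSpace ℂ H]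

instance : CoeFun (W12 H) (fun _ ↦ I → H) := ⟨toFun⟩

/-- The derivative `f'` of `f`, which is determined up to a null subset of `[0,1]`. -/
noncomputable def deriv (f : W12 H) : ℝ → H := f.exists_deriv.choose

theorem hasL2Deriv (f : W12 H) : HasL2Deriv f f.deriv := f.exists_deriv.choose_spec

theorem toFun_injective : Function.Injective (toFun : W12 H → I → H) := fun _ _ h ↦ W12.ext h

/-! ### Pointwise vector space structure -/

instance : Zero (W12 H) := ⟨⟨0, 0, HasL2Deriv.const 0⟩⟩
instance : Add (W12 H) := ⟨fun f g ↦ ⟨f.toFun + g.toFun, _, f.hasL2Deriv.add g.hasL2Deriv⟩⟩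
instance : Neg (W12 H) := ⟨fun f ↦ ⟨-f.toFun, _, f.hasL2Deriv.neg⟩⟩
instance : SMul ℂ (W12 H) := ⟨fun c f ↦ ⟨c • f.toFun, _, f.hasL2Deriv.const_smul c⟩⟩

@[simp] theorem zero_apply (t : I) : (0 : W12 H) t = 0 := rfl
@[simp] theorem add_apply (f g : W12 H) (t : I) : (f + g) t = f t + g t := rfl
@[simp] theorem neg_apply (f : W12 H) (t : I) : (-f) t = -f t := rfl
@[simp] theorem csmul_apply (c : ℂ) (f : W12 H) (t : I) : (c • f) t = c • f t := rfl

instance : AddCommGroup (W12 H) where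
  add_assoc f g h := by ext t; simp [add_assoc]
  zero_add f := by ext t; simp
  add_zero f := by ext t; simp
  add_comm f g := by ext t; simp [add_comm]
  neg_add_cancel f := by ext t; simp
  nsmul := nsmulRec
  zsmul := zsmulRec

instance : Module ℂ (W12 H) where
  one_smul f := by ext t; simp
  mul_smul a b f := by ext t; simp [mul_smul]
  smul_zero a := by ext t; simp
  smul_add a f g := by ext t; simp
  add_smul a b f := by ext t; simp [add_smul]
  zero_smul f := by ext t; simp

/-! ### Integrability facts for the inner product -/

theorem integrable_inner_of_memLp {u v : ℝ → H} {μ : Measure ℝ} (hu : MemLp u 2 μ)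
    (hv : MemLp v 2 μ) : Integrable (fun t ↦ inner ℂ (u t) (v t)) μ := by
  refine Integrable.mono' ((hu.integrable_norm_pow two_ne_zero).add
    (hv.integrable_norm_pow two_ne_zero)) (AEStronglyMeasurable.inner hu.1 hv.1)
    (Eventually.of_forall fun t ↦ (norm_inner_le_norm _ _).trans ?_)
  simp only [Pi.add_apply]
  nlinarith [sq_nonneg (‖u t‖ - ‖v t‖), sq_nonneg ‖u t‖, sq_nonneg ‖v t‖]

theorem intervalIntegrable_inner (f g : W12 H) : IntervalIntegrable
    (fun t ↦ inner ℂ (extendI f t) (extendI g t) + inner ℂ (f.deriv t) (g.deriv t))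
    volume 0 1 := by
  rw [intervalIntegrable_iff_integrableOn_Icc_of_le zero_le_one]
  exact (integrable_inner_of_memLp (f.hasL2Deriv.memLp 2) (g.hasL2Deriv.memLp 2)).add
    (integrable_inner_of_memLp f.hasL2Deriv.1 g.hasL2Deriv.1)

theorem intervalIntegrable_norm_sq (f : W12 H) :
    IntervalIntegrable (fun t ↦ ‖extendI f t‖ ^ 2 + ‖f.deriv t‖ ^ 2) volume 0 1 := by
  rw [intervalIntegrable_iff_integrableOn_Icc_of_le zero_le_one]
  exact ((f.hasL2Deriv.memLp 2).integrable_norm_pow two_ne_zero).add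
    (f.hasL2Deriv.1.integrable_norm_pow two_ne_zero)

theorem integral_inner_self (f : W12 H) :
    ∫ t in (0 : ℝ)..1, (inner ℂ (extendI f t) (extendI f t) + inner ℂ (f.deriv t) (f.deriv t)) =
      ((∫ t in (0 : ℝ)..1, (‖extendI f t‖ ^ 2 + ‖f.deriv t‖ ^ 2) : ℝ) : ℂ) := by
  rw [← intervalIntegral.integral_ofReal]
  simp [inner_self_eq_norm_sq_to_K]

theorem eq_zero_of_integral_eq_zero (f : W12 H)
    (hf : ∫ t in (0 : ℝ)..1, (‖extendI f t‖ ^ 2 + ‖f.deriv t‖ ^ 2) = 0) : f = 0 := by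
  have h0 : ∀ᵐ t ∂(volume.restrict (Icc (0 : ℝ) 1)),
      ‖extendI f t‖ ^ 2 + ‖f.deriv t‖ ^ 2 = 0 := by
    have hi := f.intervalIntegrable_norm_sq
    rw [intervalIntegrable_iff_integrableOn_Icc_of_le zero_le_one] at hi
    rw [intervalIntegral.integral_of_le zero_le_one, ← integral_Icc_eq_integral_Ioc] at hf
    exact (integral_eq_zero_iff_of_nonneg (fun t ↦ by positivity) hi).1 hf
  -- the derivative vanishes, so `f` is constant
  have hd : HasL2Deriv f 0 := by
    refine ⟨MemLp.zero, fun x ↦ ?_⟩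
    rw [f.hasL2Deriv.2 x, intervalIntegral.integral_of_le x.2.1,
      intervalIntegral.integral_of_le x.2.1]
    congr 1
    refine setIntegral_congr_ae measurableSet_Ioc ?_
    filter_upwards [(ae_restrict_iff' measurableSet_Icc).1 h0] with t ht hm
    have := ht ⟨hm.1.le, hm.2.trans x.2.2⟩
    have : ‖f.deriv t‖ ^ 2 = 0 := by nlinarith [sq_nonneg ‖extendI f t‖, sq_nonneg ‖f.deriv t‖]
    simpa using this
  have hc : ∀ x : I, f x = f 0 := fun x ↦ by simpa using hd.2 x
  have h00 : f 0 = 0 := by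
    have hne : (ae (volume.restrict (Icc (0 : ℝ) 1))).NeBot := by
      rw [ae_neBot, Ne, Measure.restrict_eq_zero]; simp
    obtain ⟨t, ht, hm⟩ := (h0.and (ae_restrict_mem measurableSet_Icc)).exists
    rw [extendI_of_mem _ hm, hc] at ht
    have : ‖f 0‖ ^ 2 = 0 := by nlinarith [sq_nonneg ‖f 0‖, sq_nonneg ‖f.deriv t‖]
    simpa using this
  ext x
  rw [hc, h00, zero_apply]

end

section

variable {H : Type*} [NormedAddCommGroup H] [InnerProductSpace ℂ H] [CompleteSpace H]

/-! ### Pointwise products -/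

instance : SMul (W12 ℂ) (W12 H) :=
  ⟨fun a f ↦ ⟨fun t ↦ a t • f t, _, a.hasL2Deriv.smul f.hasL2Deriv⟩⟩

@[simp] theorem smul_apply (a : W12 ℂ) (f : W12 H) (t : I) : (a • f) t = a t • f t := rfl

instance : One (W12 ℂ) := ⟨⟨fun _ ↦ 1, 0, HasL2Deriv.const 1⟩⟩
instance : Mul (W12 ℂ) := ⟨fun a b ↦ ⟨fun t ↦ a t * b t, _, a.hasL2Deriv.smul b.hasL2Deriv⟩⟩

@[simp] theorem one_apply (t : I) : (1 : W12 ℂ) t = 1 := rfl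
@[simp] theorem mul_apply (a b : W12 ℂ) (t : I) : (a * b) t = a t * b t := rfl

/-- `W^{1,2}[0,1]` is a commutative ring with respect to the pointwise operations. -/
noncomputable instance : CommRing (W12 ℂ) where
  __ := (inferInstance : AddCommGroup (W12 ℂ))
  mul_assoc a b c := by ext t; simp [mul_assoc]
  one_mul a := by ext t; simp
  mul_one a := by ext t; simp
  mul_comm a b := by ext t; simp [mul_comm]
  left_distrib a b c := by ext t; simp [mul_add]
  right_distrib a b c := by ext t; simp [add_mul]
  zero_mul a := by ext t; simp
  mul_zero a := by ext t; simp

noncomputable instance : Algebra ℂ (W12 ℂ) :=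
  Algebra.ofModule (fun c a b ↦ by ext t; simp [mul_assoc])
    (fun c a b ↦ by ext t; simp [mul_left_comm])

/-- `W^{1,2}([0,1], H)` is a `W^{1,2}[0,1]`-module with respect to the pointwise product. -/
noncomputable instance : Module (W12 ℂ) (W12 H) where
  one_smul f := by ext t; simp
  mul_smul a b f := by ext t; simp [mul_smul]
  smul_zero a := by ext t; simp
  smul_add a f g := by ext t; simp
  add_smul a b f := by ext t; simp [add_smul]
  zero_smul f := by ext t; simp

instance : IsScalarTower ℂ (W12 ℂ) (W12 H) :=
  ⟨fun c a f ↦ by ext t; simp [mul_smul]⟩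

/-! ### The Hilbert space structure -/

theorem deriv_add (f g : W12 H) :
    (f + g).deriv =ᵐ[volume.restrict (Icc (0 : ℝ) 1)] f.deriv + g.deriv :=
  (f + g).hasL2Deriv.unique (f.hasL2Deriv.add g.hasL2Deriv)

theorem deriv_smul (c : ℂ) (f : W12 H) :
    (c • f).deriv =ᵐ[volume.restrict (Icc (0 : ℝ) 1)] c • f.deriv :=
  (c • f).hasL2Deriv.unique (f.hasL2Deriv.const_smul c)

theorem integral_congr_I {E : Type*} [NormedAddCommGroup E] [NormedSpace ℝ E] {u v : ℝ → E}
    (h : ∀ᵐ t ∂(volume.restrict (Icc (0 : ℝ) 1)), u t = v t) :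
    ∫ t in (0 : ℝ)..1, u t = ∫ t in (0 : ℝ)..1, v t := by
  rw [intervalIntegral.integral_of_le zero_le_one, intervalIntegral.integral_of_le zero_le_one,
    ← integral_Icc_eq_integral_Ioc, ← integral_Icc_eq_integral_Ioc]
  exact integral_congr_ae h

/-- The inner product `⟪f, g⟫ = ∫₀¹ (⟪f(t), g(t)⟫ + ⟪f'(t), g'(t)⟫) dt`
(conjugate linear in the first argument, as in Mathlib). -/
@[reducible] noncomputable def innerCore : InnerProductSpace.Core ℂ (W12 H) where
  inner f g :=
    ∫ t in (0 : ℝ)..1, (inner ℂ (extendI f t) (extendI g t) + inner ℂ (f.deriv t) (g.deriv t))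
  conj_inner_symm f g := by
    rw [← intervalIntegral.intervalIntegral_conj]
    simp
  re_inner_nonneg f := by
    simp only [integral_inner_self]
    exact intervalIntegral.integral_nonneg zero_le_one fun t _ ↦ by positivity
  add_left f g h := by
    rw [← intervalIntegral.integral_add (f.intervalIntegrable_inner h)
      (g.intervalIntegrable_inner h)]
    apply integral_congr_I
    filter_upwards [deriv_add f g, ae_restrict_mem measurableSet_Icc] with t ht hm
    rw [ht]
    simp only [extendI_of_mem _ hm, add_apply, Pi.add_apply, inner_add_left]
    ring
  smul_left f g c := by
    rw [← intervalIntegral.integral_const_mul]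
    apply integral_congr_I
    filter_upwards [deriv_smul c f, ae_restrict_mem measurableSet_Icc] with t ht hm
    rw [ht]
    simp only [extendI_of_mem _ hm, csmul_apply, Pi.smul_apply, inner_smul_left]
    ring
  definite f hf := by
    simp only [integral_inner_self] at hf
    exact f.eq_zero_of_integral_eq_zero (by exact_mod_cast hf)

noncomputable instance : NormedAddCommGroup (W12 H) := innerCore.toNormedAddCommGroup
noncomputable instance : InnerProductSpace ℂ (W12 H) :=
  InnerProductSpace.ofCore innerCore.toCore

end

end W12

/-!
# Niceness of the module `W^{1,2}([0,1], H)`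

Write `A` for the algebra `W^{1,2}[0,1]` and `M` for the module `W^{1,2}([0,1], H)`. Both directions
rest on the fact that a proper ideal of `A` has a common zero in `[0,1]`
(`W12.exists_forall_mem_apply_eq_zero`), applied to the annihilator of a quotient of `M`.

If `H` is finite dimensional, then `M` is a finitely generated `A`-module. For a proper submodule
`N`, take a common zero `t` of the annihilator of `M ⧸ N`. If the values `f t` with `f ∈ N` filled
`H`, then Nakayama's lemma would give an `r ∈ A` with `r t = 1` and `r • M ≤ N`, which is
impossible. So some nonzero functional `φ` on `H` kills these values, and `N` lies in the closed
submodule `{f | φ (f t) = 0}` of codimension one.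

If `H` is infinite dimensional, let `v` be an orthonormal sequence and consider the continuous curve
`u(t) = ∑ 2⁻ⁿ exp (-2ⁿ i t) vₙ`, whose formal derivative `u'(t) = -i ∑ exp (-2ⁿ i t) vₙ` is an
unbounded functional on `H` for every `t`. The condition `⟪u', f⟫ = 0` makes sense in the weak form
`⟪u, f⟫' = ⟪u, f'⟫` and defines a proper closed submodule `N` (`W12.weakAnnihilator`). A closed
submodule `P ≥ N` of codimension one would have `A` acting on `M ⧸ P` through evaluation at a point
`t` (`W12.exists_smul_eq_apply_smul`). Since `exp (-2ⁿ i ·) vₙ - exp (-2ᵏ i ·) vₖ` is in `N`, the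
constant functions `yₙ - yₖ` with `yₙ = exp (-2ⁿ i t) vₙ` are in `P`; a vector orthogonal to all of
them is orthogonal to all `vₙ` by Bessel's inequality, and the constants with that property are in
`N`. Hence `P` contains all constants (`W12.const_mem_of_weakAnnihilator_le`) and, by density, is
all of `M` (`W12.eq_top_of_forall_const_mem`).
-/

/-! ### Operations on functions with square integrable derivative -/

namespace HasL2Deriv

section

variable {H K : Type*} [NormedAddCommGroup H] [InnerProductSpace ℂ H]
  [NormedAddCommGroup K] [InnerProductSpace ℂ K] {f : I → H} {g g' : ℝ → H}

theorem congr_deriv (h : HasL2Deriv f g) (hg : g =ᵐ[volume.restrict (Icc (0 : ℝ) 1)] g') :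
    HasL2Deriv f g' := by
  refine ⟨(memLp_congr_ae hg).1 h.1, fun x ↦ ?_⟩
  rw [h.2 x, intervalIntegral.integral_of_le x.2.1, intervalIntegral.integral_of_le x.2.1]
  congr 1
  refine setIntegral_congr_ae measurableSet_Ioc ?_
  filter_upwards [(ae_restrict_iff' measurableSet_Icc).1 hg] with t ht hm
  exact ht ⟨hm.1.le, hm.2.trans x.2.2⟩

theorem ext_of_deriv {f₁ f₂ : I → H} (h₁ : HasL2Deriv f₁ g) (h₂ : HasL2Deriv f₂ g)
    (h0 : f₁ 0 = f₂ 0) : f₁ = f₂ := by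
  ext x
  rw [h₁.2 x, h₂.2 x, h0]

theorem clm_comp [CompleteSpace H] [CompleteSpace K] (L : H →L[ℝ] K) (h : HasL2Deriv f g) :
    HasL2Deriv (fun t ↦ L (f t)) (fun t ↦ L (g t)) := by
  refine ⟨L.comp_memLp' h.1, fun x ↦ ?_⟩
  rw [L.intervalIntegral_comp_comm (h.intervalIntegrable ⟨le_rfl, zero_le_one⟩ x.2), ← map_add,
    ← h.2 x]

theorem of_hasDerivAt [CompleteSpace H] {φ φ' : ℝ → H} (h : ∀ t, HasDerivAt φ (φ' t) t)
    (hc : Continuous φ') : HasL2Deriv (fun t : I ↦ φ t) φ' := by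
  refine ⟨?_, fun x ↦ ?_⟩
  · obtain ⟨C, hC⟩ := isCompact_Icc.exists_bound_of_continuousOn
      (hc.continuousOn (s := Icc (0 : ℝ) 1))
    exact MemLp.of_bound hc.aestronglyMeasurable C
      ((ae_restrict_iff' measurableSet_Icc).2 (Eventually.of_forall hC))
  · rw [intervalIntegral.integral_eq_sub_of_hasDerivAt (fun t _ ↦ h t) (hc.intervalIntegrable _ _)]
    simp

theorem continuous (h : HasL2Deriv f g) : Continuous f := by
  have := h.continuousOn.domRestrict
  convert this using 1
  ext t
  exact (extendI_coe f t).symm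

/-- The reciprocal of a function without zeros: it is absolutely continuous because inversion is
Lipschitz away from zero, and its derivative is computed almost everywhere. -/
theorem inv {a : I → ℂ} {u : ℝ → ℂ} (ha : HasL2Deriv a u) (h0 : ∀ t, a t ≠ 0) :
    HasL2Deriv (fun t ↦ (a t)⁻¹) (fun t ↦ -u t / extendI a t ^ 2) := by
  obtain ⟨c, hc, hac⟩ : ∃ c > 0, ∀ t, c ≤ ‖a t‖ := by
    obtain ⟨t, -, ht⟩ := isCompact_univ.exists_isMinOn univ_nonempty
      ha.continuous.norm.continuousOn
    exact ⟨‖a t‖, norm_pos_iff.2 (h0 t), fun s ↦ ht (mem_univ s)⟩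
  have hne : ∀ t ∈ Icc (0 : ℝ) 1, extendI a t ≠ 0 := fun t ht ↦ by
    rw [extendI_of_mem a ht]; exact h0 _
  have hle : ∀ t ∈ Icc (0 : ℝ) 1, c ≤ ‖extendI a t‖ := fun t ht ↦ by
    rw [extendI_of_mem a ht]; exact hac _
  have z : (0 : ℝ) ∈ Icc (0 : ℝ) 1 := ⟨le_rfl, zero_le_one⟩
  have hm := (ha.memLp 2).1
  set w : ℝ → ℂ := fun t ↦ -u t / extendI a t ^ 2 with hw
  have hL : MemLp w 2 (volume.restrict (Icc (0 : ℝ) 1)) := by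
    refine ha.1.of_le_mul (c := (c ^ 2)⁻¹) ?_ ?_
    · exact (ha.1.1.neg.aemeasurable.div (hm.aemeasurable.pow_const 2)).aestronglyMeasurable
    · refine (ae_restrict_iff' measurableSet_Icc).2 (Eventually.of_forall fun t ht ↦ ?_)
      rw [hw, norm_div, norm_neg, norm_pow, div_eq_inv_mul]
      gcongr
      exact hle t ht
  let W : I → ℂ := fun x ↦ ∫ t in (0 : ℝ)..x, w t
  have hW : HasL2Deriv W w := ⟨hL, fun x ↦ by simp [W]⟩
  have hinv : AbsolutelyContinuousOnInterval (fun t ↦ (extendI a t)⁻¹) 0 1 := by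
    have key := ha.absolutelyContinuous
    rw [absolutelyContinuousOnInterval_iff] at key ⊢
    intro ε hε
    obtain ⟨δ, hδ, hE⟩ := key (ε * c ^ 2) (by positivity)
    refine ⟨δ, hδ, fun E hd hl ↦ ?_⟩
    have h1 := hE E hd hl
    rw [← div_lt_iff₀ (by positivity), Finset.sum_div] at h1
    refine lt_of_le_of_lt (Finset.sum_le_sum fun i hi ↦ ?_) h1
    have hm := hd.1 i hi
    rw [uIcc_of_le zero_le_one] at hm
    obtain ⟨hx, hy⟩ := hm
    rw [dist_eq_norm, dist_eq_norm, inv_sub_inv (hne _ hx) (hne _ hy), norm_div, norm_mul,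
      norm_sub_rev, sq]
    gcongr
    · exact hle _ hx
    · exact hle _ hy
  have hd : ∀ᵐ x : ℝ, x ∈ uIcc (0 : ℝ) 1 →
      HasDerivAt ((fun t ↦ (extendI a t)⁻¹) - extendI W) 0 x := by
    filter_upwards [ha.ae_hasDerivAt, hW.ae_hasDerivAt] with x h1 h3 hx
    rw [uIcc_of_le zero_le_one] at hx
    have := ((h1 hx).fun_inv (hne x hx)).sub (h3 hx)
    rwa [hw, sub_self] at this
  obtain ⟨C, hC⟩ := (hinv.sub hW.absolutelyContinuous).const_of_ae_hasDerivAt_zero hd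
  rw [uIcc_of_le zero_le_one] at hC
  refine ⟨hL, fun x ↦ ?_⟩
  have e1 := (hC x x.2).trans (hC 0 z).symm
  have e2 : extendI W 0 = 0 := by
    rw [extendI_of_mem W z]; simp [W]
  have e0 : extendI a 0 = a 0 := extendI_of_mem a z
  simp only [Pi.sub_apply, extendI_coe, e0, e2, sub_zero] at e1
  exact sub_eq_iff_eq_add.1 e1

end

end HasL2Deriv

/-! ### Norm estimates and bounded operators on `W^{1,2}` -/

namespace W12

section

variable {H : Type*} [NormedAddCommGroup H]

/-- The Cauchy–Schwarz inequality `‖g‖₁² ≤ ‖g‖₂²` on an interval of length one. -/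
theorem sq_integral_norm_le {g : ℝ → H} (hg : MemLp g 2 (volume.restrict (Icc (0 : ℝ) 1))) :
    (∫ t in (0 : ℝ)..1, ‖g t‖) ^ 2 ≤ ∫ t in (0 : ℝ)..1, ‖g t‖ ^ 2 := by
  have h1 : IntervalIntegrable (fun t ↦ ‖g t‖) volume 0 1 := by
    rw [intervalIntegrable_iff_integrableOn_Icc_of_le zero_le_one]
    exact (hg.integrable (by norm_num)).norm
  have h2 : IntervalIntegrable (fun t ↦ ‖g t‖ ^ 2) volume 0 1 := by
    rw [intervalIntegrable_iff_integrableOn_Icc_of_le zero_le_one]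
    exact hg.integrable_norm_pow two_ne_zero
  set c := ∫ t in (0 : ℝ)..1, ‖g t‖ with hc
  have h3 : 0 ≤ ∫ t in (0 : ℝ)..1, (‖g t‖ ^ 2 - 2 * c * ‖g t‖ + c ^ 2) :=
    intervalIntegral.integral_nonneg zero_le_one fun t _ ↦ by nlinarith [sq_nonneg (‖g t‖ - c)]
  rw [intervalIntegral.integral_add (h2.sub (h1.const_mul _)) (by simp),
    intervalIntegral.integral_sub h2 (h1.const_mul _), intervalIntegral.integral_const_mul,
    ← hc] at h3
  simp only [intervalIntegral.integral_const, sub_zero, one_smul] at h3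
  nlinarith

variable [InnerProductSpace ℂ H]

theorem norm_integral_le {g : ℝ → H} (hg : IntegrableOn g (Icc (0 : ℝ) 1)) {a b : ℝ}
    (ha : a ∈ Icc (0 : ℝ) 1) (hb : b ∈ Icc (0 : ℝ) 1) :
    ‖∫ t in a..b, g t‖ ≤ ∫ t in (0 : ℝ)..1, ‖g t‖ := by
  rw [intervalIntegral.integral_of_le zero_le_one, ← integral_Icc_eq_integral_Ioc]
  refine intervalIntegral.norm_integral_le_integral_norm_uIoc.trans ?_
  exact setIntegral_mono_set hg.norm (Eventually.of_forall fun _ ↦ norm_nonneg _)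
    (uIoc_subset_uIcc.trans (uIcc_subset_Icc ha hb)).eventuallyLE

theorem hasL2Deriv_primitive {g : ℝ → H} (hg : MemLp g 2 (volume.restrict (Icc (0 : ℝ) 1))) :
    HasL2Deriv (fun x : I ↦ ∫ t in (0 : ℝ)..x, g t) g :=
  ⟨hg, fun x ↦ by simp⟩

/-- The function on `[0,1]` with constant value `h`. -/
def const (h : H) : W12 H := ⟨fun _ ↦ h, 0, HasL2Deriv.const h⟩

@[simp] theorem const_apply (h : H) (t : I) : const h t = h := rfl

end

variable {H : Type*} [NormedAddCommGroup H] [InnerProductSpace ℂ H] [CompleteSpace H]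

theorem deriv_ae_eq {f : W12 H} {g : ℝ → H} (h : HasL2Deriv f g) :
    f.deriv =ᵐ[volume.restrict (Icc (0 : ℝ) 1)] g :=
  f.hasL2Deriv.unique h

theorem norm_sq_eq (f : W12 H) :
    ‖f‖ ^ 2 = ∫ t in (0 : ℝ)..1, (‖extendI f t‖ ^ 2 + ‖f.deriv t‖ ^ 2) := by
  have h : inner ℂ f f = _ := integral_inner_self f
  rw [@norm_sq_eq_re_inner ℂ, h]
  exact Complex.ofReal_re _

theorem integral_norm_deriv_sq_le (f : W12 H) : ∫ t in (0 : ℝ)..1, ‖f.deriv t‖ ^ 2 ≤ ‖f‖ ^ 2 := by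
  rw [norm_sq_eq]
  refine intervalIntegral.integral_mono_on zero_le_one ?_ f.intervalIntegrable_norm_sq
    fun t _ ↦ by nlinarith [sq_nonneg ‖extendI f t‖]
  rw [intervalIntegrable_iff_integrableOn_Icc_of_le zero_le_one]
  exact f.hasL2Deriv.1.integrable_norm_pow two_ne_zero

theorem integral_norm_deriv_le (f : W12 H) : ∫ t in (0 : ℝ)..1, ‖f.deriv t‖ ≤ ‖f‖ :=
  (abs_le_of_sq_le_sq' ((sq_integral_norm_le f.hasL2Deriv.1).trans f.integral_norm_deriv_sq_le)
    (norm_nonneg f)).2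

/-- `W^{1,2}` embeds continuously into the bounded functions: average the bound
`‖f x‖ ≤ ‖f t‖ + ∫ ‖f'‖` over `t`. -/
theorem norm_apply_le (f : W12 H) (x : I) : ‖f x‖ ≤ 2 * ‖f‖ := by
  set c := ∫ t in (0 : ℝ)..1, ‖f.deriv t‖ with hc
  have z : (0 : ℝ) ∈ Icc (0 : ℝ) 1 := ⟨le_rfl, zero_le_one⟩
  have h1 : ∀ t ∈ Icc (0 : ℝ) 1, ‖f x‖ ≤ ‖extendI f t‖ + c := fun t ht ↦ by
    have : f x = extendI f t + ∫ s in t..x, f.deriv s := by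
      rw [f.hasL2Deriv.extendI_eq ht, f.hasL2Deriv.2 x, add_assoc,
        intervalIntegral.integral_add_adjacent_intervals (f.hasL2Deriv.intervalIntegrable z ht)
          (f.hasL2Deriv.intervalIntegrable ht x.2)]
    rw [this]
    exact (norm_add_le _ _).trans
      (add_le_add_right (norm_integral_le f.hasL2Deriv.integrableOn ht x.2) _)
  have h2 : IntervalIntegrable (fun t ↦ ‖extendI f t‖) volume 0 1 := by
    rw [intervalIntegrable_iff_integrableOn_Icc_of_le zero_le_one]
    exact ((f.hasL2Deriv.memLp 2).integrable (by norm_num)).norm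
  have h3 : ‖f x‖ ≤ (∫ t in (0 : ℝ)..1, ‖extendI f t‖) + c := by
    have := intervalIntegral.integral_mono_on (zero_le_one : (0 : ℝ) ≤ 1)
      (f := fun _ ↦ ‖f x‖) (g := fun t ↦ ‖extendI f t‖ + c) (μ := volume) (by simp)
      (h2.add (by simp)) h1
    rw [intervalIntegral.integral_add h2 (by simp)] at this
    simpa using this
  have h4 : ∫ t in (0 : ℝ)..1, ‖extendI f t‖ ≤ ‖f‖ := by
    refine (abs_le_of_sq_le_sq' ((sq_integral_norm_le (f.hasL2Deriv.memLp 2)).trans ?_)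
      (norm_nonneg f)).2
    rw [norm_sq_eq]
    refine intervalIntegral.integral_mono_on zero_le_one ?_ f.intervalIntegrable_norm_sq
      fun t _ ↦ by nlinarith [sq_nonneg ‖f.deriv t‖]
    rw [intervalIntegrable_iff_integrableOn_Icc_of_le zero_le_one]
    exact (f.hasL2Deriv.memLp 2).integrable_norm_pow two_ne_zero
  linarith [f.integral_norm_deriv_le]

/-- Evaluation at a point of `[0,1]`. -/
noncomputable def evalCLM (x : I) : W12 H →L[ℂ] H :=
  LinearMap.mkContinuous
    { toFun := fun f ↦ f x, map_add' := fun _ _ ↦ rfl, map_smul' := fun _ _ ↦ rfl } 2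
    fun f ↦ f.norm_apply_le x

@[simp] theorem evalCLM_apply (x : I) (f : W12 H) : evalCLM x f = f x := rfl

theorem norm_sq_le_of_hasL2Deriv {f : W12 H} {g : ℝ → H} (h : HasL2Deriv f g) (h0 : f 0 = 0) :
    ‖f‖ ^ 2 ≤ 2 * ∫ t in (0 : ℝ)..1, ‖g t‖ ^ 2 := by
  have hi : IntervalIntegrable (fun t ↦ ‖g t‖ ^ 2) volume 0 1 := by
    rw [intervalIntegrable_iff_integrableOn_Icc_of_le zero_le_one]
    exact h.1.integrable_norm_pow two_ne_zero
  have he : ‖f‖ ^ 2 = ∫ t in (0 : ℝ)..1, (‖extendI f t‖ ^ 2 + ‖g t‖ ^ 2) := by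
    rw [norm_sq_eq]
    apply integral_congr_I
    filter_upwards [deriv_ae_eq h] with t ht
    rw [ht]
  have hi2 : IntervalIntegrable (fun t ↦ ‖extendI f t‖ ^ 2) volume 0 1 := by
    rw [intervalIntegrable_iff_integrableOn_Icc_of_le zero_le_one]
    exact (f.hasL2Deriv.memLp 2).integrable_norm_pow two_ne_zero
  have hb : ∫ t in (0 : ℝ)..1, ‖extendI f t‖ ^ 2 ≤
      ∫ _ in (0 : ℝ)..1, (∫ t in (0 : ℝ)..1, ‖g t‖ ^ 2) := by
    refine intervalIntegral.integral_mono_on zero_le_one hi2 (by simp) fun t ht ↦ ?_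
    rw [h.extendI_eq ht, h0, zero_add]
    refine le_trans ?_ (sq_integral_norm_le h.1)
    gcongr
    exact norm_integral_le h.integrableOn ⟨le_rfl, zero_le_one⟩ ht
  rw [he, intervalIntegral.integral_add hi2 hi]
  simp only [intervalIntegral.integral_const, sub_zero, one_smul] at hb
  linarith

/-- The indefinite integral `g ↦ ∫₀ˣ g(t) dt` as a bounded operator from `L²([0,1], H)` to
`W^{1,2}([0,1], H)`. -/
noncomputable def primitive : Lp H 2 (volume.restrict (Icc (0 : ℝ) 1)) →L[ℂ] W12 H :=
  LinearMap.mkContinuous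
    { toFun := fun g ↦ ⟨_, g, hasL2Deriv_primitive (Lp.memLp g)⟩
      map_add' := fun g₁ g₂ ↦ W12.ext <|
        ((hasL2Deriv_primitive (Lp.memLp (g₁ + g₂))).congr_deriv (Lp.coeFn_add g₁ g₂)).ext_of_deriv
          ((hasL2Deriv_primitive (Lp.memLp g₁)).add (hasL2Deriv_primitive (Lp.memLp g₂))) (by simp)
      map_smul' := fun c g ↦ W12.ext <|
        ((hasL2Deriv_primitive (Lp.memLp (c • g))).congr_deriv (Lp.coeFn_smul c g)).ext_of_deriv
          ((hasL2Deriv_primitive (Lp.memLp g)).const_smul c) (by simp) }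
    2 fun g ↦ by
      have h2 : ∫ t in (0 : ℝ)..1, ‖g t‖ ^ 2 = ‖g‖ ^ 2 := by
        rw [@norm_sq_eq_re_inner ℂ, L2.inner_def, intervalIntegral.integral_of_le zero_le_one,
          ← integral_Icc_eq_integral_Ioc, ← integral_re (L2.integrable_inner g g)]
        simp [← Complex.ofReal_pow]
      have h1 := norm_sq_le_of_hasL2Deriv (f := ⟨_, g, hasL2Deriv_primitive (Lp.memLp g)⟩)
        (hasL2Deriv_primitive (Lp.memLp g)) (by simp)
      rw [h2] at h1
      refine (abs_le_of_sq_le_sq' (h1.trans ?_) (by positivity)).2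
      nlinarith [sq_nonneg ‖g‖]

theorem primitive_apply (g : Lp H 2 (volume.restrict (Icc (0 : ℝ) 1))) (x : I) :
    primitive g x = ∫ t in (0 : ℝ)..x, g t := rfl

theorem norm_const_le (h : H) : ‖const h‖ ≤ ‖h‖ := by
  have h1 : ‖const h‖ ^ 2 = ‖h‖ ^ 2 := by
    rw [norm_sq_eq, integral_congr_I (v := fun _ ↦ ‖h‖ ^ 2)]
    · simp
    · filter_upwards [deriv_ae_eq (f := const h) (HasL2Deriv.const h),
        ae_restrict_mem measurableSet_Icc] with t ht hm
      simp [ht, extendI_of_mem _ hm]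
  exact (abs_le_of_sq_le_sq' h1.le (norm_nonneg h)).2

/-- The embedding of `H` into `W^{1,2}([0,1], H)` as the constant functions. -/
noncomputable def constCLM : H →L[ℂ] W12 H :=
  LinearMap.mkContinuous
    { toFun := const, map_add' := fun _ _ ↦ rfl, map_smul' := fun _ _ ↦ rfl } 1
    fun h ↦ (norm_const_le h).trans_eq (one_mul _).symm

end W12

/-! ### Ideals of `W^{1,2}[0,1]` -/

namespace W12

/-- Composition with a real linear operator. -/
noncomputable def map {H K : Type*} [NormedAddCommGroup H] [InnerProductSpace ℂ H]
    [NormedAddCommGroup K] [InnerProductSpace ℂ K] [CompleteSpace H] [CompleteSpace K]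
    (L : H →L[ℝ] K) (f : W12 H) : W12 K :=
  ⟨fun t ↦ L (f t), _, f.hasL2Deriv.clm_comp L⟩

/-- A proper ideal of `W^{1,2}[0,1]` has a common zero. Otherwise compactness yields finitely many
`aᵢ` in the ideal without common zero, and `∑ conj aᵢ * aᵢ` is then invertible. -/
theorem exists_forall_mem_apply_eq_zero {J : Ideal (W12 ℂ)} (hJ : J ≠ ⊤) :
    ∃ t : I, ∀ a ∈ J, a t = 0 := by
  by_contra! h
  choose a haJ ha using h
  obtain ⟨T, -, hT⟩ := isCompact_univ.elim_nhds_subcover (fun t ↦ {s | a t s ≠ 0}) fun t _ ↦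
    (isOpen_ne_fun (a t).hasL2Deriv.continuous continuous_const).mem_nhds (ha t)
  set b : W12 ℂ := ∑ t ∈ T, map (Complex.conjCLE : ℂ →L[ℝ] ℂ) (a t) * a t with hb
  have hbJ : b ∈ J := J.sum_mem fun t _ ↦ J.mul_mem_left _ (haJ t)
  have hbs : ∀ s, b s = ((∑ t ∈ T, ‖a t s‖ ^ 2 : ℝ) : ℂ) := fun s ↦ by
    rw [← evalCLM_apply, hb, map_sum, Complex.ofReal_sum]
    refine Finset.sum_congr rfl fun t _ ↦ ?_
    rw [Complex.ofReal_pow, ← Complex.conj_mul']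
    rfl
  have hb0 : ∀ s, b s ≠ 0 := fun s ↦ by
    rw [hbs, Complex.ofReal_ne_zero]
    obtain ⟨t, ht, hs⟩ := mem_iUnion₂.1 (hT (mem_univ s))
    have : 0 < ‖a t s‖ ^ 2 := pow_pos (norm_pos_iff.2 hs) 2
    exact (this.trans_le (Finset.single_le_sum (f := fun t ↦ ‖a t s‖ ^ 2)
      (fun _ _ ↦ by positivity) ht)).ne'
  refine hJ ((Ideal.eq_top_iff_one J).2 ?_)
  convert J.mul_mem_left ⟨fun t ↦ (b t)⁻¹, _, b.hasL2Deriv.inv hb0⟩ hbJ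
  ext t
  exact (inv_mul_cancel₀ (hb0 t)).symm

/-- The ideal of functions vanishing at `t`. -/
def vanishingIdeal (t : I) : Ideal (W12 ℂ) where
  carrier := {a | a t = 0}
  zero_mem' := rfl
  add_mem' {a b} (ha : a t = 0) (hb : b t = 0) := by simp [ha, hb]
  smul_mem' c a (ha : a t = 0) := by simp [ha]

/-! ### Finite dimensional fibres -/

variable {H : Type*} [NormedAddCommGroup H] [InnerProductSpace ℂ H] [CompleteSpace H]

section FiniteDimensional

variable {ι : Type*} (b : Module.Basis ι ℂ H)

/-- The coordinates, with respect to a finite basis of `H`, of a function with values in `H`. -/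
noncomputable def coord [FiniteDimensional ℂ H] (f : W12 H) (j : ι) : W12 ℂ :=
  map ((LinearMap.toContinuousLinearMap (b.coord j)).restrictScalars ℝ) f

theorem coord_apply [FiniteDimensional ℂ H] (f : W12 H) (j : ι) (t : I) :
    coord b f j t = b.repr (f t) j := rfl

theorem sum_coord_smul_const [Fintype ι] [FiniteDimensional ℂ H] (f : W12 H) :
    ∑ j, coord b f j • const (b j) = f := by
  ext t
  rw [← evalCLM_apply, map_sum]
  simp [coord_apply, b.sum_repr]

theorem fg_top [FiniteDimensional ℂ H] : (⊤ : Submodule (W12 ℂ) (W12 H)).FG := by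
  let b := Module.finBasis ℂ H
  refine Submodule.fg_iff_exists_finite_generating_family.2
    ⟨Fin (Module.finrank ℂ H), inferInstance, fun j ↦ const (b j), top_le_iff.1 fun f _ ↦ ?_⟩
  rw [← sum_coord_smul_const b f]
  exact Submodule.sum_mem _ fun j _ ↦ Submodule.smul_mem _ _ (Submodule.subset_span ⟨j, rfl⟩)

theorem mem_vanishingIdeal_smul_top [FiniteDimensional ℂ H] {t : I} {f : W12 H} (hf : f t = 0) :
    f ∈ vanishingIdeal t • (⊤ : Submodule (W12 ℂ) (W12 H)) := by
  let b := Module.finBasis ℂ H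
  rw [← sum_coord_smul_const b f]
  refine Submodule.sum_mem _ fun j _ ↦ Submodule.smul_mem_smul ?_ Submodule.mem_top
  change coord b f j t = 0
  simp [coord_apply, hf]

/-- By Nakayama's lemma, a proper submodule of `W^{1,2}([0,1], H)` with `dim H < ∞` has a fibre
which is not the whole of `H`. -/
theorem exists_map_eval_ne_top [FiniteDimensional ℂ H] {N : Submodule (W12 ℂ) (W12 H)}
    (hN : N ≠ ⊤) :
    ∃ t : I, (N.restrictScalars ℂ).map (evalCLM (H := H) t).toLinearMap ≠ ⊤ := by
  have hJ : Module.annihilator (W12 ℂ) (W12 H ⧸ N) ≠ ⊤ := by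
    rw [Ne, Module.annihilator_eq_top_iff, Submodule.Quotient.subsingleton_iff]
    exact hN
  obtain ⟨t, ht⟩ := exists_forall_mem_apply_eq_zero hJ
  refine ⟨t, fun htop ↦ ?_⟩
  have hle : ⊤ ≤ N ⊔ vanishingIdeal t • ⊤ := fun f _ ↦ by
    obtain ⟨n, hn, hnf⟩ : f t ∈ (N.restrictScalars ℂ).map (evalCLM (H := H) t).toLinearMap :=
      htop ▸ Submodule.mem_top
    rw [← add_sub_cancel n f]
    refine Submodule.add_mem_sup hn (mem_vanishingIdeal_smul_top ?_)
    rw [← evalCLM_apply, map_sub, sub_eq_zero]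
    exact hnf.symm
  obtain ⟨r, hr, hrN⟩ :=
    Submodule.exists_sub_one_mem_and_smul_le_of_fg_of_le_sup (fg_top (H := H)) le_rfl hle
  have h1 : r t - 1 = 0 := by
    have : evalCLM t (r - 1) = 0 := hr
    rwa [map_sub] at this
  have h0 : r t = 0 := ht r <| Module.mem_annihilator.2 fun y ↦ by
    obtain ⟨f, rfl⟩ := Submodule.Quotient.mk_surjective N y
    rw [← Submodule.Quotient.mk_smul, Submodule.Quotient.mk_eq_zero]
    exact hrN (Submodule.smul_mem_pointwise_smul f r ⊤ trivial)
  simp [h0] at h1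

end FiniteDimensional

/-- The submodule of all `f` with `φ (f t) = 0`. -/
def fibreKer (t : I) (φ : H →ₗ[ℂ] ℂ) : Submodule (W12 ℂ) (W12 H) where
  carrier := {f | φ (f t) = 0}
  zero_mem' := map_zero φ
  add_mem' {f g} (hf : φ (f t) = 0) (hg : φ (g t) = 0) := by simp [hf, hg]
  smul_mem' c f (hf : φ (f t) = 0) := by simp [hf]

theorem finrank_quotient_fibreKer (t : I) {φ : H →ₗ[ℂ] ℂ} (hφ : φ ≠ 0) :
    Module.finrank ℂ (W12 H ⧸ fibreKer t φ) = 1 := by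
  let Φ : W12 H →ₗ[ℂ] ℂ := φ ∘ₗ (evalCLM (H := H) t).toLinearMap
  have hs : Function.Surjective Φ := fun c ↦ by
    obtain ⟨h, hh⟩ := LinearMap.surjective hφ c
    exact ⟨const h, hh⟩
  have he : (fibreKer t φ).restrictScalars ℂ = LinearMap.ker Φ := rfl
  rw [((Submodule.Quotient.restrictScalarsEquiv ℂ (fibreKer t φ)).symm.trans
    ((Submodule.quotEquivOfEq _ _ he).trans (Φ.quotKerEquivOfSurjective hs))).finrank_eq,
    Module.finrank_self]

theorem isNiceModule_of_finiteDimensional [FiniteDimensional ℂ H] :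
    IsNiceModule (W12 ℂ) (W12 H) := by
  intro N _ hN
  obtain ⟨t, ht⟩ := exists_map_eval_ne_top hN
  obtain ⟨φ, hφ, hle⟩ := Submodule.exists_le_ker_of_lt_top _ (lt_top_iff_ne_top.2 ht)
  refine ⟨fibreKer t φ, ?_, fun f hf ↦ hle (Submodule.mem_map_of_mem hf),
    finrank_quotient_fibreKer t hφ⟩
  exact isClosed_singleton.preimage
    ((LinearMap.continuous_of_finiteDimensional φ).comp (evalCLM t).continuous)

end W12

/-! ### Quotients of codimension one and density of the constants -/

namespace W12

variable {H : Type*} [NormedAddCommGroup H] [InnerProductSpace ℂ H]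

theorem memLp_inner {u : ℝ → H} (hu : Continuous u) {g : ℝ → H}
    (hg : MemLp g 2 (volume.restrict (Icc (0 : ℝ) 1))) :
    MemLp (fun t ↦ inner ℂ (u t) (g t)) 2 (volume.restrict (Icc (0 : ℝ) 1)) := by
  obtain ⟨C, hC⟩ := isCompact_Icc.exists_bound_of_continuousOn
    (hu.continuousOn (s := Icc (0 : ℝ) 1))
  refine hg.of_le_mul (c := C) (hu.aestronglyMeasurable.inner hg.1) ?_
  refine (ae_restrict_iff' measurableSet_Icc).2 (Eventually.of_forall fun t ht ↦ ?_)
  exact (norm_inner_le_norm _ _).trans (by gcongr; exact hC t ht)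

variable [CompleteSpace H]

/-- A module over `W^{1,2}[0,1]` of complex dimension one is the residue field at a point: a
function acts on it through its value at some fixed `t`. -/
theorem exists_smul_eq_apply_smul {V : Type*} [AddCommGroup V] [Module ℂ V] [Module (W12 ℂ) V]
    [IsScalarTower ℂ (W12 ℂ) V] (hV : Module.finrank ℂ V = 1) :
    ∃ t : I, ∀ (a : W12 ℂ) (y : V), a • y = a t • y := by
  have : Nontrivial V := Module.nontrivial_of_finrank_pos (R := ℂ) (by omega)
  obtain ⟨t, ht⟩ := exists_forall_mem_apply_eq_zero (J := Module.annihilator (W12 ℂ) V) (by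
    rw [Ne, Module.annihilator_eq_top_iff]
    exact not_subsingleton V)
  refine ⟨t, fun a y ↦ ?_⟩
  have : SMulCommClass (W12 ℂ) ℂ V := IsScalarTower.to_smulCommClass'
  obtain ⟨v, hv⟩ := exists_ne (0 : V)
  have hspan := (finrank_eq_one_iff_of_nonzero' v hv).1 hV
  obtain ⟨c, hc⟩ := hspan (a • v)
  have hc' : ∀ y : V, a • y = c • y := fun y ↦ by
    obtain ⟨d, rfl⟩ := hspan y
    rw [smul_comm a d v, ← hc, smul_comm]
  have hmem : a - c • (1 : W12 ℂ) ∈ Module.annihilator (W12 ℂ) V :=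
    Module.mem_annihilator.2 fun y ↦ by
      rw [sub_smul, smul_assoc, one_smul, hc', sub_self]
  have h0 : evalCLM t (a - c • (1 : W12 ℂ)) = 0 := ht _ hmem
  have : a t - c * 1 = 0 := by rwa [map_sub] at h0
  rw [hc', sub_eq_zero.1 this, mul_one]

/-- A closed submodule which contains all constant functions is everything, because the
primitives of step functions together with the constants span a dense subspace. -/
theorem eq_top_of_forall_const_mem {P : Submodule (W12 ℂ) (W12 H)} (hP : IsClosed (P : Set (W12 H)))
    (hc : ∀ h : H, const h ∈ P) : P = ⊤ := by
  have hprim : ∀ g : Lp H 2 (volume.restrict (Icc (0 : ℝ) 1)), primitive g ∈ P := by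
    refine Lp.induction (by simp) _ ?_ ?_ (hP.preimage primitive.continuous)
    · intro h s hs hμ
      have hmem : MemLp (s.indicator fun _ ↦ (1 : ℂ)) 2 (volume.restrict (Icc (0 : ℝ) 1)) :=
        memLp_indicator_const 2 hs 1 (Or.inr hμ.ne)
      let a : W12 ℂ := ⟨_, _, hasL2Deriv_primitive hmem⟩
      have ha : primitive (Lp.simpleFunc.indicatorConst 2 hs hμ.ne h) = a • const h := by
        refine W12.ext ((hasL2Deriv_primitive (Lp.memLp _)).ext_of_deriv
          ((HasL2Deriv.smul (hasL2Deriv_primitive hmem) (HasL2Deriv.const h)).congr_deriv ?_) ?_)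
        · rw [Lp.simpleFunc.coe_indicatorConst]
          filter_upwards [indicatorConstLp_coeFn (p := 2) (hs := hs) (hμs := hμ.ne) (c := h),
            ae_restrict_mem measurableSet_Icc] with t ht hm
          rw [ht, extendI_of_mem _ hm]
          by_cases hts : t ∈ s <;> simp [hts]
        · simp [a]
      rw [ha]
      exact P.smul_mem a (hc h)
    · intro f g hf hg _ h1 h2
      rw [map_add]
      exact P.add_mem h1 h2
  refine top_le_iff.1 fun f _ ↦ ?_
  have : f = const (f 0) + primitive f.hasL2Deriv.1.toLp := by
    refine W12.ext ?_
    refine f.hasL2Deriv.ext_of_deriv (((HasL2Deriv.const (f 0)).add ((hasL2Deriv_primitive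
      (Lp.memLp _)).congr_deriv f.hasL2Deriv.1.coeFn_toLp)).congr_deriv ?_) ?_
    · simp
    · simp [primitive_apply]
  rw [this]
  exact P.add_mem (hc _) (hprim _)

/-! ### The weak annihilator of the derivative of a curve -/

section

variable {u : ℝ → H}

variable (u) in
/-- The functions `f` for which `⟪u, f⟫` is absolutely continuous with derivative `⟪u, f'⟫`. For
absolutely continuous `u` this means `⟪u', f⟫ = 0` almost everywhere. -/
def weakAnnihilator : Submodule (W12 ℂ) (W12 H) where
  carrier := {f | HasL2Deriv (fun t : I ↦ inner ℂ (u t) (f t)) fun t ↦ inner ℂ (u t) (f.deriv t)}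
  zero_mem' := by
    have h : HasL2Deriv (fun t : I ↦ inner ℂ (u t) ((0 : W12 H) t)) 0 := by
      simpa using HasL2Deriv.const (0 : ℂ)
    refine h.congr_deriv ?_
    filter_upwards [deriv_ae_eq (f := (0 : W12 H)) (HasL2Deriv.const 0)] with t ht
    simp [ht]
  add_mem' {f g} hf hg := by
    have h := HasL2Deriv.add hf hg
    simp only [mem_ofPred_eq, add_apply, inner_add_right]
    refine h.congr_deriv ?_
    filter_upwards [deriv_add f g] with t ht
    simp [ht]
  smul_mem' a f hf := by
    have h := HasL2Deriv.smul a.hasL2Deriv hf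
    simp only [mem_ofPred_eq, smul_apply, inner_smul_right]
    refine h.congr_deriv ?_
    filter_upwards [deriv_ae_eq (f := a • f) (a.hasL2Deriv.smul f.hasL2Deriv),
      ae_restrict_mem measurableSet_Icc] with t ht hm
    simp [ht, extendI_of_mem _ hm]

/-- Membership does not depend on the choice of the derivative on a null set. -/
theorem mem_weakAnnihilator_iff {f : W12 H} {g : ℝ → H} (h : HasL2Deriv f g) :
    f ∈ weakAnnihilator u ↔
      HasL2Deriv (fun t : I ↦ inner ℂ (u t) (f t)) fun t ↦ inner ℂ (u t) (g t) := by
  have key : (fun t ↦ inner ℂ (u t) (f.deriv t)) =ᵐ[volume.restrict (Icc (0 : ℝ) 1)]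
      fun t ↦ inner ℂ (u t) (g t) := by
    filter_upwards [deriv_ae_eq h] with t ht
    rw [ht]
  exact ⟨fun h ↦ h.congr_deriv key, fun h ↦ h.congr_deriv key.symm⟩

/-- The functional `f ↦ ∫₀ˣ ⟪u, f'⟫`. -/
noncomputable def integralInnerDeriv (hu : Continuous u) (x : I) : W12 H →L[ℂ] ℂ := by
  have hint : ∀ f : W12 H, IntervalIntegrable (fun t ↦ inner ℂ (u t) (f.deriv t)) volume 0 x :=
    fun f ↦ (hasL2Deriv_primitive (memLp_inner hu f.hasL2Deriv.1)).intervalIntegrable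
      ⟨le_rfl, zero_le_one⟩ x.2
  have hae : ∀ {v w : ℝ → H}, v =ᵐ[volume.restrict (Icc (0 : ℝ) 1)] w →
      ∫ t in (0 : ℝ)..x, inner ℂ (u t) (v t) = ∫ t in (0 : ℝ)..x, inner ℂ (u t) (w t) := by
    intro v w h
    refine intervalIntegral.integral_congr_ae_restrict (ae_restrict_of_ae_restrict_of_subset
      (uIoc_subset_uIcc.trans (uIcc_subset_Icc ⟨le_rfl, zero_le_one⟩ x.2)) ?_)
    filter_upwards [h] with t ht
    rw [ht]
  refine LinearMap.mkContinuousOfExistsBound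
    { toFun := fun f ↦ ∫ t in (0 : ℝ)..x, inner ℂ (u t) (f.deriv t)
      map_add' := fun f g ↦ ?_
      map_smul' := fun c f ↦ ?_ } ?_
  · rw [hae (deriv_add f g), ← intervalIntegral.integral_add (hint f) (hint g)]
    simp
  · rw [hae (deriv_smul c f)]
    simp
  · obtain ⟨C, hC⟩ := isCompact_Icc.exists_bound_of_continuousOn
      (hu.continuousOn (s := Icc (0 : ℝ) 1))
    have hC0 : 0 ≤ C := (norm_nonneg _).trans (hC 0 ⟨le_rfl, zero_le_one⟩)
    refine ⟨C, fun f ↦ ?_⟩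
    have hf := f.hasL2Deriv.intervalIntegrable ⟨le_rfl, zero_le_one⟩ ⟨zero_le_one, le_rfl⟩
    have hi : IntervalIntegrable (fun t ↦ inner ℂ (u t) (f.deriv t)) volume 0 1 :=
      (hasL2Deriv_primitive (memLp_inner hu f.hasL2Deriv.1)).intervalIntegrable
        ⟨le_rfl, zero_le_one⟩ ⟨zero_le_one, le_rfl⟩
    calc ‖∫ t in (0 : ℝ)..x, inner ℂ (u t) (f.deriv t)‖
        ≤ ∫ t in (0 : ℝ)..1, ‖inner ℂ (u t) (f.deriv t)‖ :=
          norm_integral_le ((intervalIntegrable_iff_integrableOn_Icc_of_le zero_le_one).1 hi)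
            ⟨le_rfl, zero_le_one⟩ x.2
      _ ≤ ∫ t in (0 : ℝ)..1, C * ‖f.deriv t‖ := by
          refine intervalIntegral.integral_mono_on zero_le_one hi.norm (hf.norm.const_mul C)
            fun t ht ↦ (norm_inner_le_norm _ _).trans ?_
          gcongr
          exact hC t ht
      _ ≤ C * ‖f‖ := by
          rw [intervalIntegral.integral_const_mul]
          gcongr
          exact f.integral_norm_deriv_le

theorem isClosed_weakAnnihilator (hu : Continuous u) :
    IsClosed (weakAnnihilator u : Set (W12 H)) := by
  have : (weakAnnihilator u : Set (W12 H)) = ⋂ x : I, {f | inner ℂ (u x) (evalCLM x f) =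
      inner ℂ (u 0) (evalCLM 0 f) + integralInnerDeriv hu x f} := by
    ext f
    simp only [mem_iInter]
    exact ⟨fun h ↦ h.2, fun h ↦ ⟨memLp_inner hu f.hasL2Deriv.1, h⟩⟩
  rw [this]
  refine isClosed_iInter fun x ↦ isClosed_eq ?_ ?_ <;> fun_prop

end

end W12

/-! ### A rough curve in an infinite dimensional space -/

theorem exists_orthonormal_nat {H : Type*} [NormedAddCommGroup H] [InnerProductSpace ℂ H]
    (h : ¬ FiniteDimensional ℂ H) : ∃ v : ℕ → H, Orthonormal ℂ v := by
  let b := Module.Free.chooseBasis ℂ H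
  have : Infinite (Module.Free.ChooseBasisIndex ℂ H) := by
    by_contra hfin
    rw [not_infinite_iff_finite] at hfin
    exact h (Module.Finite.of_basis b)
  exact ⟨_, InnerProductSpace.gramSchmidtNormed_orthonormal
    (b.linearIndependent.comp _ (Infinite.natEmbedding _).injective)⟩

namespace W12

/-- The exponential `t ↦ exp (-2ⁿ i t)`. -/
noncomputable def phase (n : ℕ) (t : ℝ) : ℂ := Complex.exp (-(2 ^ n * t * Complex.I))

theorem hasDerivAt_phase (n : ℕ) (t : ℝ) :
    HasDerivAt (phase n) (-(2 ^ n * Complex.I) * phase n t) t := by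
  have h : HasDerivAt (fun t : ℝ ↦ -(2 ^ n * (t : ℂ) * Complex.I)) (-(2 ^ n * 1 * Complex.I)) t :=
    ((Complex.ofRealCLM.hasDerivAt.const_mul _).mul_const _).neg
  refine h.cexp.congr_deriv ?_
  simp only [phase]
  ring

theorem continuous_phase (n : ℕ) : Continuous (phase n) := by
  unfold phase; fun_prop

theorem norm_phase (n : ℕ) (t : ℝ) : ‖phase n t‖ = 1 := by
  have := Complex.norm_exp_ofReal_mul_I (-(2 ^ n * t))
  rw [← this, phase]
  congr 2
  push_cast
  ring

theorem conj_phase_mul_phase (n : ℕ) (t : ℝ) : conj (phase n t) * phase n t = 1 := by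
  rw [Complex.conj_mul', norm_phase]; simp

theorem hasL2Deriv_phase (n : ℕ) :
    HasL2Deriv (fun t : I ↦ phase n t) fun t ↦ -(2 ^ n * Complex.I) * phase n t :=
  HasL2Deriv.of_hasDerivAt (hasDerivAt_phase n) (continuous_const.mul (continuous_phase n))

/-- The exponential `phase n` as an element of `W^{1,2}[0,1]`. -/
noncomputable def phaseW (n : ℕ) : W12 ℂ := ⟨_, _, hasL2Deriv_phase n⟩

theorem phaseW_apply (n : ℕ) (t : I) : phaseW n t = phase n t := rfl

variable {H : Type*} [NormedAddCommGroup H] [InnerProductSpace ℂ H]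

/-- The continuous, nowhere differentiable curve `u(t) = ∑ 2⁻ⁿ exp (-2ⁿ i t) vₙ`. -/
noncomputable def roughCurve (v : ℕ → H) (t : ℝ) : H := ∑' n, ((1 / 2 : ℂ) ^ n * phase n t) • v n

variable {v : ℕ → H}

theorem norm_roughCurve_term (hv : Orthonormal ℂ v) (n : ℕ) (t : ℝ) :
    ‖((1 / 2 : ℂ) ^ n * phase n t) • v n‖ = (1 / 2 : ℝ) ^ n := by
  rw [norm_smul, hv.norm_eq_one, norm_mul, norm_phase]; simp

variable [CompleteSpace H]

theorem summable_roughCurve (hv : Orthonormal ℂ v) (t : ℝ) :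
    Summable fun n ↦ ((1 / 2 : ℂ) ^ n * phase n t) • v n :=
  .of_norm_bounded summable_geometric_two fun n ↦ (norm_roughCurve_term hv n t).le

theorem continuous_roughCurve (hv : Orthonormal ℂ v) : Continuous (roughCurve v) :=
  continuous_tsum (fun n ↦ (continuous_const.mul (continuous_phase n)).smul continuous_const)
    summable_geometric_two fun n t ↦ (norm_roughCurve_term hv n t).le

theorem inner_roughCurve (hv : Orthonormal ℂ v) (t : ℝ) (n : ℕ) :
    inner ℂ (roughCurve v t) (v n) = (1 / 2 : ℂ) ^ n * conj (phase n t) := by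
  have h := (summable_roughCurve hv t).hasSum.mapL (innerSL ℂ (v n))
  have h' : HasSum (fun k ↦ inner ℂ (v n) (((1 / 2 : ℂ) ^ k * phase k t) • v k))
    ((1 / 2 : ℂ) ^ n * phase n t) := by
    convert hasSum_single n fun k hk ↦ ?_ using 1
    · rw [inner_smul_right, inner_self_eq_norm_sq_to_K, hv.norm_eq_one]; simp
    · rw [inner_smul_right, hv.inner_eq_zero hk.symm, mul_zero]
  rw [← inner_conj_symm, show inner ℂ (v n) (roughCurve v t) = _ from h.unique h']
  simp [Complex.conj_ofNat]

theorem inner_roughCurve_eq_zero (hv : Orthonormal ℂ v) {z : H} (hz : ∀ n, inner ℂ z (v n) = 0)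
    (t : ℝ) : inner ℂ (roughCurve v t) z = 0 := by
  have h := (summable_roughCurve hv t).hasSum.mapL (innerSL ℂ z)
  have h0 : inner ℂ z (roughCurve v t) = 0 := by
    refine h.unique ?_
    convert hasSum_zero with n
    change inner ℂ z _ = _
    rw [inner_smul_right, hz, mul_zero]
  rw [← inner_conj_symm, h0, map_zero]

theorem const_mem_weakAnnihilator (hv : Orthonormal ℂ v) {z : H}
    (hz : ∀ n, inner ℂ z (v n) = 0) : const z ∈ weakAnnihilator (roughCurve v) := by
  rw [mem_weakAnnihilator_iff (HasL2Deriv.const z)]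
  simp only [const_apply, inner_roughCurve_eq_zero hv hz, Pi.zero_apply, inner_zero_right]
  exact HasL2Deriv.const 0

/-- Formally, `⟪u', ·⟫` takes the value `i` on `phase n • vₙ`, whatever `n` is. Rigorously,
`⟪u, phase n • vₙ⟫` is constant and `⟪u, (phase n • vₙ)'⟫ = -i` for all `n`. -/
theorem phase_sub_phase_mem_weakAnnihilator (hv : Orthonormal ℂ v) (n k : ℕ) :
    phaseW n • const (v n) - phaseW k • const (v k) ∈ weakAnnihilator (roughCurve v) := by
  have h1 (n : ℕ) : HasL2Deriv (phaseW n • const (v n))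
      fun t ↦ (-(2 ^ n * Complex.I) * phase n t) • v n :=
    (HasL2Deriv.smul (hasL2Deriv_phase n) (HasL2Deriv.const (v n))).congr_deriv <| by
      filter_upwards [ae_restrict_mem measurableSet_Icc] with t ht
      simp [extendI_of_mem _ ht]
  have h2 (n : ℕ) (t : ℝ) (c : ℂ) :
      inner ℂ (roughCurve v t) ((c * phase n t) • v n) = c * (1 / 2) ^ n := by
    rw [inner_smul_right, inner_roughCurve hv]
    linear_combination c * (1 / 2) ^ n * conj_phase_mul_phase n t
  have h3 (n : ℕ) (t : ℝ) :
      inner ℂ (roughCurve v t) ((phase n t) • v n) = (1 / 2) ^ n := by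
    simpa using h2 n t 1
  rw [sub_eq_add_neg, mem_weakAnnihilator_iff ((h1 n).add (h1 k).neg)]
  have h4 (n : ℕ) : -((2 : ℂ) ^ n * Complex.I) * (1 / 2) ^ n = -Complex.I := by
    have : (2 : ℂ) ^ n * (1 / 2) ^ n = 1 := by rw [← mul_pow]; norm_num
    linear_combination (-Complex.I) * this
  convert HasL2Deriv.const (((1 / 2) ^ n : ℂ) - (1 / 2) ^ k) using 1
  · ext t
    simp only [add_apply, neg_apply, smul_apply, const_apply, phaseW_apply, inner_add_right,
      inner_neg_right, h3]
    ring
  · ext t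
    simp only [Pi.add_apply, Pi.neg_apply, inner_add_right, inner_neg_right, h2, h4]
    simp

theorem const_notMem_weakAnnihilator (hv : Orthonormal ℂ v) :
    const (v 0) ∉ weakAnnihilator (roughCurve v) := by
  rw [mem_weakAnnihilator_iff (HasL2Deriv.const _)]
  intro h
  -- otherwise `⟪u, v₀⟫ = exp (i t)` would be constant on `[0,1]`
  have := h.2 1
  simp only [const_apply, inner_roughCurve hv, phase, Pi.zero_apply, inner_zero_right,
    intervalIntegral.integral_zero, ← Complex.exp_conj] at this
  have h2 := congrArg Complex.im this
  simp [Complex.exp_im] at h2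
  exact (Real.sin_pos_of_pos_of_le_one one_pos le_rfl).ne' h2

/-- If `P` contains the weak annihilator of the rough curve and has codimension one, with
`W^{1,2}[0,1]` acting on the quotient through evaluation at `t`, then `P` contains the constants
`yₙ - yₖ`, where `yₙ = phase n t • vₙ` is orthonormal, and those orthogonal to all `vₙ`. Bessel's
inequality shows that these span a dense subspace of `H`. -/
theorem const_mem_of_weakAnnihilator_le (hv : Orthonormal ℂ v) {P : Submodule (W12 ℂ) (W12 H)}
    (hP : IsClosed (P : Set (W12 H))) (hle : weakAnnihilator (roughCurve v) ≤ P)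
    (hrank : Module.finrank ℂ (W12 H ⧸ P) = 1) (h : H) : const h ∈ P := by
  obtain ⟨t, ht⟩ := exists_smul_eq_apply_smul hrank
  let Z : Submodule ℂ H := (P.restrictScalars ℂ).comap constCLM.toLinearMap
  have hZ : IsClosed (Z : Set H) := hP.preimage constCLM.continuous
  have : CompleteSpace Z := hZ.completeSpace_coe
  suffices Z = ⊤ by
    have : h ∈ Z := this ▸ Submodule.mem_top
    exact this
  rw [← Submodule.orthogonal_eq_bot_iff, Submodule.eq_bot_iff]
  intro z hz
  have hy : ∀ n k, phase n t • v n - phase k t • v k ∈ Z := fun n k ↦ by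
    change const (phase n t • v n - phase k t • v k) ∈ P
    have h1 := hle (phase_sub_phase_mem_weakAnnihilator hv n k)
    rw [← Submodule.Quotient.mk_eq_zero] at h1 ⊢
    rw [← h1, Submodule.Quotient.mk_sub, Submodule.Quotient.mk_smul, Submodule.Quotient.mk_smul,
      ht, ht, phaseW_apply, phaseW_apply]
    change Submodule.Quotient.mk (constCLM _) = _
    rw [map_sub, map_smul, map_smul]
    rfl
  -- the moduli of the coefficients of `z` are constant and square summable, hence zero
  have hconst : ∀ n, ‖inner ℂ (v n) z‖ = ‖inner ℂ (v 0) z‖ := fun n ↦ by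
    have h0 := hz _ (hy n 0)
    rw [inner_sub_left, inner_smul_left, inner_smul_left, sub_eq_zero] at h0
    have := congrArg norm h0
    simpa [norm_phase] using this
  have hzero : ‖inner ℂ (v 0) z‖ ^ 2 = 0 := by
    have := (hv.inner_products_summable (x := z)).tendsto_atTop_zero
    simp only [hconst] at this
    exact tendsto_nhds_unique tendsto_const_nhds this
  have hzv : ∀ n, inner ℂ z (v n) = 0 := fun n ↦ by
    rw [← norm_eq_zero, norm_inner_symm, hconst, ← sq_eq_zero_iff, hzero]
  have hzZ : z ∈ Z := hle (const_mem_weakAnnihilator hv hzv)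
  exact inner_self_eq_zero.1 (hz z hzZ)

end W12

/-! ### The characterization of niceness -/

theorem theorem1p5 (H : Type*) [NormedAddCommGroup H] [InnerProductSpace ℂ H] [CompleteSpace H] :
    IsNiceModule (W12 ℂ) (W12 H) ↔ FiniteDimensional ℂ H := by
  refine ⟨fun hnice ↦ ?_, fun _ ↦ W12.isNiceModule_of_finiteDimensional⟩
  by_contra hH
  obtain ⟨v, hv⟩ := exists_orthonormal_nat hH
  obtain ⟨P, hP, hle, hrank⟩ := hnice (W12.weakAnnihilator (W12.roughCurve v))
    (W12.isClosed_weakAnnihilator (W12.continuous_roughCurve hv))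
    fun h ↦ W12.const_notMem_weakAnnihilator hv (h ▸ Submodule.mem_top)
  have htop := W12.eq_top_of_forall_const_mem hP
    (W12.const_mem_of_weakAnnihilator_le hv hP hle hrank)
  subst htop
  rw [Module.finrank_zero_of_subsingleton] at hrank
  exact zero_ne_one hrank
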